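/- Let $n\ge 0$ be an integer. For a field $F$, a Lie algebra law on $F^n$ is an $F$-bilinear map $\mu:F^n\times F^n\to F^n$ that is skew-symmetric, $\mu(X,Y)=-\mu(Y,X)$, and satisfies the Jacobi identity; it is identified with its structure constants $C_{ij}^k$, $\mu(e_i,e_j)=\sum_k C_{ij}^k e_k$. Two laws $\mu',\mu$ on $F^n$ are $F$-isomorphic if there is $f\in GL(n,F)$ with $\mu'(X,Y)=f^{-1}(\mu(f(X),f(Y)))$ for all $X,Y\in F^n$. Let $L^n$ be the algebraic variety of Lie algebra laws on $\mathbb C^n$, with the Zariski topology of the space of structure constants. A Lie algebra $\mathfrak g=(\mathbb C^n,\mu)$ is rigid if its orbit $\mathcal O(\mu)$, the set of laws on $\mathbb C^n$ that are $\mathbb C$-isomorphic to $\mu$, is Zariski open in $L^n$. Let $\mathbb C^*$ be a nonstandard extension of $\mathbb C$ in the sense of Robinson: a field containing $\mathbb C$ and different from $\mathbb C$, together with an extension of every finitary function and relation on $\mathbb C$ (the field operations being the extensions of those of $\mathbb C$), such that $\mathbb C$ and $\mathbb C^*$ satisfy the same first-order sentences in the language of all these functions and relations (constants included). An element of $\mathbb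 C^*$ is limited if its modulus is at most some standard real number, and infinitesimal if its modulus is smaller than every standard real number $r>0$. A perturbation of $\mathfrak g=(\mathbb C^n,\mu)$ is a Lie algebra law $\mu'$ on $(\mathbb C^*)^n$ whose structure constants are limited and differ from those of $\mu$ by infinitesimals. Theorem. Let $\mathfrak g=(\mathbb C^n,\mu)$ be an $n$-dimensional complex Lie algebra. Then $\mathfrak g$ is rigid if and only if every perturbation $\mathfrak g'=((\mathbb C^*)^n,\mu')$ of $\mathfrak g$ is $\mathbb C^*$-isomorphic to $\mathfrak g$, that is, to the Lie algebra on $(\mathbb C^*)^n$ with the same structure constants as $\mathfrak g$. -/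

import Mathlib

open scoped FirstOrder

namespace LieRigidity

/-! ## Lie algebra laws on `Fⁿ`, given by their structure constants -/

/-- Index set of the structure constants: `(i, j, k)` stands for the coefficient of `e_k`
in `μ(e_i, e_j)`. -/
abbrev Idx (n : ℕ) : Type := Fin n × Fin n × Fin n

/-- The bilinear map on `Fⁿ` with structure constants `c`. -/
def bracket {n : ℕ} {F : Type*} [Field F] (c : Idx n → F) (X Y : Fin n → F) : Fin n → F :=
  fun k => ∑ i, ∑ j, X i * Y j * c (i, j, k)

/-- `c` is the family of structure constants of a Lie algebra law on `Fⁿ`: the bracket is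
skew-symmetric and satisfies the Jacobi identity. -/
def IsLieLaw {n : ℕ} {F : Type*} [Field F] (c : Idx n → F) : Prop :=
  (∀ X Y : Fin n → F, bracket c X Y = -bracket c Y X) ∧
    ∀ X Y Z : Fin n → F,
      bracket c X (bracket c Y Z) + bracket c Y (bracket c Z X) +
        bracket c Z (bracket c X Y) = 0

/-- The laws `c'` and `c` on `Fⁿ` are `F`-isomorphic: there is `f ∈ GL(n, F)` with
`μ'(X, Y) = f⁻¹(μ(f X, f Y))`. -/
def IsIsomorphicLaw {n : ℕ} {F : Type*} [Field F] (c' c : Idx n → F) : Prop :=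
  ∃ f : (Fin n → F) ≃ₗ[F] (Fin n → F),
    ∀ X Y : Fin n → F, bracket c' X Y = f.symm (bracket c (f X) (f Y))

/-! ## The variety of complex Lie algebra laws, orbits and rigidity -/

/-- The variety `Lⁿ` of Lie algebra laws on `ℂⁿ`, in the space of structure constants. -/
def lieVariety (n : ℕ) : Set (Idx n → ℂ) := {c | IsLieLaw c}

/-- The orbit of a law under `GL(n, ℂ)`: the laws isomorphic to it. -/
def orbit {n : ℕ} (c : Idx n → ℂ) : Set (Idx n → ℂ) := {c' | IsIsomorphicLaw c' c}

/-- `O` is open in `L` for the topology induced on `L` by the Zariski topology of `ℂ^σ`. -/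
def IsZariskiOpenIn {σ : Type*} (L O : Set (σ → ℂ)) : Prop :=
  ∃ I : Ideal (MvPolynomial σ ℂ), O = L \ MvPolynomial.zeroLocus ℂ I

/-- The complex Lie algebra with structure constants `c` is rigid: its orbit is Zariski open
in the variety of Lie algebra laws. -/
def IsRigid {n : ℕ} (c : Idx n → ℂ) : Prop :=
  IsZariskiOpenIn (lieVariety n) (orbit c)

/-! ## Nonstandard extensions of `ℂ` in the sense of Robinson -/

/-- The full first-order language of `ℂ`: a symbol for every finitary function (constants
included, as the functions of arity `0`) and for every finitary relation on `ℂ`. -/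
def fullLang : FirstOrder.Language.{0, 0} where
  Functions k := (Fin k → ℂ) → ℂ
  Relations k := Set (Fin k → ℂ)

/-- `ℂ` with the standard interpretation of all symbols of its full language. -/
instance fullStructure : fullLang.Structure ℂ where
  funMap {_} f v := f v
  RelMap := fun {k} (R : Set (Fin k → ℂ)) v => v ∈ R

section Extension

variable {K : Type*} [fullLang.Structure K]

/-- The extension `*f : K^k → K` of a function `f : ℂ^k → ℂ`. -/
def starFun {k : ℕ} (f : (Fin k → ℂ) → ℂ) (v : Fin k → K) : K :=
  FirstOrder.Language.Structure.funMap (L := fullLang) (M := K) (n := k) f v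

/-- The extension `*A ⊆ K^k` of a set `A ⊆ ℂ^k`. -/
def starSet {k : ℕ} (A : Set (Fin k → ℂ)) : Set (Fin k → K) :=
  {v | FirstOrder.Language.Structure.RelMap (L := fullLang) (M := K) (n := k) A v}

/-- The embedding `ℂ → K` of the standard complex numbers. -/
def std (K : Type*) [fullLang.Structure K] (z : ℂ) : K :=
  starFun (k := 0) (fun _ => z) Fin.elim0

/-- `x` is limited (not infinitely large): `|x| ≤ r` for some standard real `r`. -/
def IsLimited (x : K) : Prop :=
  ∃ r : ℝ, ![x] ∈ starSet (K := K) {v : Fin 1 → ℂ | ‖v 0‖ ≤ r}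

/-- `x` is infinitesimal: `|x| < r` for every standard real `r > 0`. -/
def IsInfinitesimal (x : K) : Prop :=
  ∀ r : ℝ, 0 < r → ![x] ∈ starSet (K := K) {v : Fin 1 → ℂ | ‖v 0‖ < r}

end Extension

/-- The field `K` is a nonstandard extension of `ℂ` in the sense of Robinson: every function and
relation on `ℂ` has an extension to `K` (the addition and multiplication of `K` being the extensions
of those of `ℂ`), `K` satisfies the same first-order sentences as `ℂ` in the language of all these
functions and relations (transfer principle), and `K` has an element that is not standard. -/
structure IsRobinsonExtension (K : Type*) [Field K] [fullLang.Structure K] : Prop where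
  add_eq : ∀ x y : K, starFun (fun v : Fin 2 → ℂ => v 0 + v 1) ![x, y] = x + y
  mul_eq : ∀ x y : K, starFun (fun v : Fin 2 → ℂ => v 0 * v 1) ![x, y] = x * y
  transfer : ℂ ≅[fullLang] K
  exists_nonstandard : ∃ x : K, ∀ z : ℂ, x ≠ std K z

/-- The law on `Kⁿ` with the same structure constants as the complex law `c`. -/
def extendLaw {n : ℕ} (K : Type*) [fullLang.Structure K] (c : Idx n → ℂ) : Idx n → K :=
  fun a => std K (c a)

/-- `c'` is a perturbation of the complex law `c`: a Lie algebra law on `Kⁿ` whose structure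
constants are limited and infinitely close to those of `c`. -/
def IsPerturbation {n : ℕ} {K : Type*} [Field K] [fullLang.Structure K]
    (c' : Idx n → K) (c : Idx n → ℂ) : Prop :=
  IsLieLaw c' ∧ (∀ a, IsLimited (c' a)) ∧ ∀ a, IsInfinitesimal (c' a - std K (c a))

end LieRigidity

/-!
Both conditions are equivalent to a third one: for some `ε > 0`, every Lie algebra law whose
structure constants differ from those of `μ` by less than `ε` is isomorphic to `μ`.

*Perturbations.* The statement that all laws within `ε` of `μ` are isomorphic to `μ` is first-order,
so for a standard `ε` it passes to the extension, where it applies to every perturbation. If on the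
other hand no `ε` works, the statement "for every `e ≠ 0` there is a law within `|e|` of `μ` and not
isomorphic to it" is transferred and applied to an infinitesimal `e ≠ 0`
(`exists_forall_isIsomorphicLaw_iff`). Such an `e` is the difference of a nonstandard limited
element and its standard part, or the inverse of an infinitely large element. In place of explicit
formulas, `SameTerm` and `SameFormula` record that two objects, one over `ℂ` and one over the
extension, are interpretations of the same term or formula.

*Rigidity.* Zariski open sets are open for the usual topology. For the converse, an orbit that
contains a neighbourhood of `μ` in the variety `L` of laws is open in `L` for the usual topology,
by homogeneity, and it is the projection of an algebraic set. It is Zariski open for the following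
reason (`isZariskiOpenIn_of_forall_mem_nhds`). Let `x` be a point of the orbit `O` in the Zariski
closure of `L \ O`, and `V ∋ x` an irreducible component of that closure. By Chevalley's theorem, a
nonempty Zariski open subset of `V` is contained in `O` or disjoint from `O`
(`exists_notMem_forall_mem_projection`). The first is impossible since `L \ O` is Zariski dense
in `V`; the second since nonempty Zariski open subsets of `V` are dense in `V` for the usual
topology (`exists_mem_zeroLocus_aeval_ne_zero`), so that one of them meets `O` near `x`.

The density statement comes from Noether normalization: `V` is finite over an affine space, which
is normal, so a function `a` on `V` takes at the points over `y` all the roots of its minimal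
polynomial specialised at `y`. If `a` vanishes at `p` and at no other point over the projection of
`p`, small roots at nearby `y` give points of `V` near `p`, and `y` can be chosen off a given
hypersurface.
-/

open scoped FirstOrder

namespace LieRigidity

/-! ### Transfer of first-order statements -/

section Transfer

open FirstOrder FirstOrder.Language

variable {K : Type*} [fullLang.Structure K] {σ τ : Type*}

/-- The functions `f` on `ℂ^σ` and `g` on `K^σ` are interpretations of one and the same term. -/
def SameTerm (f : (σ → ℂ) → ℂ) (g : (σ → K) → K) : Prop :=
  ∃ t : fullLang.Term σ, (∀ v, t.realize v = f v) ∧ ∀ v, t.realize v = g v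

/-- The predicates `P` on `ℂ^σ` and `Q` on `K^σ` are interpretations of one and the same
first-order formula. -/
def SameFormula (P : (σ → ℂ) → Prop) (Q : (σ → K) → Prop) : Prop :=
  ∃ φ : fullLang.Formula σ, (∀ v, φ.Realize v ↔ P v) ∧ ∀ v, φ.Realize v ↔ Q v

namespace SameTerm

theorem var (i : σ) : SameTerm (K := K) (fun v => v i) (fun v => v i) :=
  ⟨.var i, fun _ => rfl, fun _ => rfl⟩

theorem func {k : ℕ} (F : (Fin k → ℂ) → ℂ) {f : Fin k → (σ → ℂ) → ℂ}
    {g : Fin k → (σ → K) → K} (h : ∀ i, SameTerm (f i) (g i)) :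
    SameTerm (fun v => F fun i => f i v) (fun v => starFun F fun i => g i v) := by
  choose t h₁ h₂ using h
  exact ⟨Term.func (L := fullLang) (l := k) F t, fun v => congrArg F (funext fun i => h₁ i v),
    fun v => congrArg (starFun F) (funext fun i => h₂ i v)⟩

theorem const (z : ℂ) : SameTerm (σ := σ) (fun _ => z) (fun _ => std K z) := by
  have := func (σ := σ) (K := K) (k := 0) (fun _ => z) (f := Fin.elim0) (g := Fin.elim0)
    (fun i => i.elim0)
  convert this using 3
  rw [std]
  congr
  exact Subsingleton.elim _ _

theorem relabel {f : (σ → ℂ) → ℂ} {g : (σ → K) → K} (h : SameTerm f g) (e : σ → τ) :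
    SameTerm (fun w => f fun i => w (e i)) (fun w => g fun i => w (e i)) := by
  obtain ⟨t, h₁, h₂⟩ := h
  exact ⟨t.relabel e, fun w => by rw [Term.realize_relabel, h₁]; rfl,
    fun w => by rw [Term.realize_relabel, h₂]; rfl⟩

end SameTerm

namespace SameFormula

variable {P P' : (σ → ℂ) → Prop} {Q Q' : (σ → K) → Prop}

theorem eq {f f' : (σ → ℂ) → ℂ} {g g' : (σ → K) → K} (h : SameTerm f g) (h' : SameTerm f' g') :
    SameFormula (fun v => f v = f' v) (fun v => g v = g' v) := by
  obtain ⟨t, h₁, h₂⟩ := h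
  obtain ⟨t', h₁', h₂'⟩ := h'
  exact ⟨t.equal t', fun v => by simp [h₁, h₁'], fun v => by simp [h₂, h₂']⟩

theorem rel {k : ℕ} (A : Set (Fin k → ℂ)) {f : Fin k → (σ → ℂ) → ℂ}
    {g : Fin k → (σ → K) → K} (h : ∀ i, SameTerm (f i) (g i)) :
    SameFormula (fun v => (fun i => f i v) ∈ A) (fun v => (fun i => g i v) ∈ starSet A) := by
  choose t h₁ h₂ using h
  refine ⟨Relations.formula (L := fullLang) (n := k) A t, fun v => ?_, fun v => ?_⟩
  · refine Formula.realize_rel.trans ?_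
    rw [funext fun i => h₁ i v]
    rfl
  · refine Formula.realize_rel.trans ?_
    rw [funext fun i => h₂ i v]
    rfl

theorem rel₁ (A : Set (Fin 1 → ℂ)) {f : (σ → ℂ) → ℂ} {g : (σ → K) → K} (h : SameTerm f g) :
    SameFormula (fun v => ![f v] ∈ A) (fun v => ![g v] ∈ starSet A) := by
  simpa only [Matrix.vec_single_eq_const] using
    rel A (f := fun _ => f) (g := fun _ => g) (fun _ => h)

theorem rel₂ (A : Set (Fin 2 → ℂ)) {f f' : (σ → ℂ) → ℂ} {g g' : (σ → K) → K}
    (h : SameTerm f g) (h' : SameTerm f' g') :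
    SameFormula (fun v => ![f v, f' v] ∈ A) (fun v => ![g v, g' v] ∈ starSet A) := by
  convert rel A (f := ![f, f']) (g := ![g, g'])
    (fun i => by fin_cases i <;> assumption) using 4 with v i v i <;>
    fin_cases i <;> rfl

theorem not (h : SameFormula P Q) : SameFormula (fun v => ¬P v) (fun v => ¬Q v) := by
  obtain ⟨φ, h₁, h₂⟩ := h
  exact ⟨φ.not, fun v => by rw [Formula.realize_not, h₁], fun v => by rw [Formula.realize_not, h₂]⟩

theorem and (h : SameFormula P Q) (h' : SameFormula P' Q') :
    SameFormula (fun v => P v ∧ P' v) (fun v => Q v ∧ Q' v) := by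
  obtain ⟨φ, h₁, h₂⟩ := h
  obtain ⟨ψ, h₁', h₂'⟩ := h'
  exact ⟨φ ⊓ ψ, fun v => by rw [Formula.realize_inf, h₁, h₁'],
    fun v => by rw [Formula.realize_inf, h₂, h₂']⟩

theorem imp (h : SameFormula P Q) (h' : SameFormula P' Q') :
    SameFormula (fun v => P v → P' v) (fun v => Q v → Q' v) := by
  obtain ⟨φ, h₁, h₂⟩ := h
  obtain ⟨ψ, h₁', h₂'⟩ := h'
  exact ⟨φ.imp ψ, fun v => by rw [Formula.realize_imp, h₁, h₁'],
    fun v => by rw [Formula.realize_imp, h₂, h₂']⟩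

theorem finiteAll {ι : Type*} [Finite ι] {P : ι → (σ → ℂ) → Prop} {Q : ι → (σ → K) → Prop}
    (h : ∀ i, SameFormula (P i) (Q i)) :
    SameFormula (fun v => ∀ i, P i v) (fun v => ∀ i, Q i v) := by
  choose φ h₁ h₂ using h
  exact ⟨Formula.iInf φ, fun v => by simp only [Formula.realize_iInf, h₁],
    fun v => by simp only [Formula.realize_iInf, h₂]⟩

theorem finiteEx {ι : Type*} [Finite ι] {P : ι → (σ → ℂ) → Prop} {Q : ι → (σ → K) → Prop}
    (h : ∀ i, SameFormula (P i) (Q i)) :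
    SameFormula (fun v => ∃ i, P i v) (fun v => ∃ i, Q i v) := by
  choose φ h₁ h₂ using h
  exact ⟨Formula.iSup φ, fun v => by simp only [Formula.realize_iSup, h₁],
    fun v => by simp only [Formula.realize_iSup, h₂]⟩

theorem all [Finite τ] {P : (σ → ℂ) → (τ → ℂ) → Prop} {Q : (σ → K) → (τ → K) → Prop}
    (h : SameFormula (σ := σ ⊕ τ) (fun w => P (fun i => w (.inl i)) (fun i => w (.inr i)))
      (fun w => Q (fun i => w (.inl i)) (fun i => w (.inr i)))) :
    SameFormula (fun v => ∀ x, P v x) (fun v => ∀ x, Q v x) := by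
  obtain ⟨φ, h₁, h₂⟩ := h
  exact ⟨φ.iAlls τ, fun v => by simp [Formula.realize_iAlls, h₁],
    fun v => by simp [Formula.realize_iAlls, h₂]⟩

theorem ex [Finite τ] {P : (σ → ℂ) → (τ → ℂ) → Prop} {Q : (σ → K) → (τ → K) → Prop}
    (h : SameFormula (σ := σ ⊕ τ) (fun w => P (fun i => w (.inl i)) (fun i => w (.inr i)))
      (fun w => Q (fun i => w (.inl i)) (fun i => w (.inr i)))) :
    SameFormula (fun v => ∃ x, P v x) (fun v => ∃ x, Q v x) := by
  obtain ⟨φ, h₁, h₂⟩ := h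
  exact ⟨φ.iExs τ, fun v => by simp [Formula.realize_iExs, h₁],
    fun v => by simp [Formula.realize_iExs, h₂]⟩

/-- The transfer principle, with standard parameters `m`. -/
theorem transfer (hK : ℂ ≅[fullLang] K) (h : SameFormula P Q) (m : σ → ℂ) :
    P m ↔ Q (fun i => std K (m i)) := by
  obtain ⟨φ, h₁, h₂⟩ := h
  choose c hc₁ hc₂ using fun i : σ => SameTerm.const (K := K) (σ := Empty) (m i)
  have key := elementarilyEquivalent_iff.1 hK (BoundedFormula.subst φ c)
  rw [← h₁, ← h₂]
  simp only [Sentence.Realize, Formula.Realize, BoundedFormula.realize_subst] at key ⊢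
  simpa only [hc₁, hc₂] using key

end SameFormula

end Transfer

section Field

variable {K : Type*} [Field K] [fullLang.Structure K] {σ : Type*}

namespace IsRobinsonExtension

theorem sameTerm_add (hK : IsRobinsonExtension K) {f f' : (σ → ℂ) → ℂ} {g g' : (σ → K) → K}
    (h : SameTerm f g) (h' : SameTerm f' g') :
    SameTerm (fun v => f v + f' v) (fun v => g v + g' v) := by
  have := SameTerm.func (fun v : Fin 2 → ℂ => v 0 + v 1) (f := ![f, f']) (g := ![g, g'])
    (fun i => by fin_cases i <;> assumption)
  convert this using 1
  · rfl
  funext v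
  rw [← hK.add_eq]
  congr 1
  exact funext fun i => by fin_cases i <;> rfl

theorem sameTerm_mul (hK : IsRobinsonExtension K) {f f' : (σ → ℂ) → ℂ} {g g' : (σ → K) → K}
    (h : SameTerm f g) (h' : SameTerm f' g') :
    SameTerm (fun v => f v * f' v) (fun v => g v * g' v) := by
  have := SameTerm.func (fun v : Fin 2 → ℂ => v 0 * v 1) (f := ![f, f']) (g := ![g, g'])
    (fun i => by fin_cases i <;> assumption)
  convert this using 1
  · rfl
  funext v
  rw [← hK.mul_eq]
  congr 1
  exact funext fun i => by fin_cases i <;> rfl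

theorem std_injective (hK : IsRobinsonExtension K) : Function.Injective (std K) := by
  intro a b hab
  exact ((SameFormula.eq (SameTerm.var 0) (SameTerm.var 1)).transfer hK.transfer ![a, b]).2 hab

theorem std_add (hK : IsRobinsonExtension K) (a b : ℂ) : std K (a + b) = std K a + std K b :=
  ((SameFormula.eq (SameTerm.var 2) (hK.sameTerm_add (SameTerm.var 0) (SameTerm.var 1))).transfer
    hK.transfer ![a, b, a + b]).1 rfl

theorem std_mul (hK : IsRobinsonExtension K) (a b : ℂ) : std K (a * b) = std K a * std K b :=
  ((SameFormula.eq (SameTerm.var 2) (hK.sameTerm_mul (SameTerm.var 0) (SameTerm.var 1))).transfer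
    hK.transfer ![a, b, a * b]).1 rfl

theorem std_zero (hK : IsRobinsonExtension K) : std K 0 = 0 := by
  simpa using hK.std_add 0 0

theorem std_one (hK : IsRobinsonExtension K) : std K 1 = 1 := by
  have h := hK.std_mul 1 1
  have h0 : std K 1 ≠ 0 := fun h => one_ne_zero (hK.std_injective (h.trans hK.std_zero.symm))
  rw [mul_one] at h
  exact mul_left_cancel₀ h0 (by rw [← h, mul_one])

theorem std_neg (hK : IsRobinsonExtension K) (a : ℂ) : std K (-a) = -std K a :=
  eq_neg_of_add_eq_zero_left (by rw [← hK.std_add, neg_add_cancel, hK.std_zero])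

theorem sameTerm_zero (hK : IsRobinsonExtension K) :
    SameTerm (σ := σ) (K := K) (fun _ => 0) (fun _ => 0) := by
  simpa only [hK.std_zero] using SameTerm.const (K := K) (σ := σ) 0

theorem sameTerm_neg (hK : IsRobinsonExtension K) {f : (σ → ℂ) → ℂ} {g : (σ → K) → K}
    (h : SameTerm f g) : SameTerm (fun v => -f v) (fun v => -g v) := by
  have := hK.sameTerm_mul (SameTerm.const (-1)) h
  simpa only [hK.std_neg, hK.std_one, neg_one_mul] using this

theorem sameTerm_sub (hK : IsRobinsonExtension K) {f f' : (σ → ℂ) → ℂ} {g g' : (σ → K) → K}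
    (h : SameTerm f g) (h' : SameTerm f' g') :
    SameTerm (fun v => f v - f' v) (fun v => g v - g' v) := by
  simpa only [sub_eq_add_neg] using hK.sameTerm_add h (hK.sameTerm_neg h')

theorem sameTerm_sum (hK : IsRobinsonExtension K) {ι : Type*} (s : Finset ι)
    {f : ι → (σ → ℂ) → ℂ} {g : ι → (σ → K) → K} (h : ∀ i, SameTerm (f i) (g i)) :
    SameTerm (fun v => ∑ i ∈ s, f i v) (fun v => ∑ i ∈ s, g i v) := by
  classical
  induction s using Finset.induction_on with
  | empty => simpa using hK.sameTerm_zero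
  | insert a s ha ih => simpa only [Finset.sum_insert ha] using hK.sameTerm_add (h a) ih

end IsRobinsonExtension

end Field

/-! ### Zariski open subsets of irreducible varieties are dense -/

section Density

open MvPolynomial

/-- A point of the zero locus of `P` as a homomorphism on the coordinate ring. -/
noncomputable def evalQuotient {σ : Type*} {P : Ideal (MvPolynomial σ ℂ)} {q : σ → ℂ}
    (hq : q ∈ zeroLocus ℂ P) : MvPolynomial σ ℂ ⧸ P →ₐ[ℂ] ℂ :=
  Ideal.Quotient.liftₐ P (aeval q) hq

theorem evalQuotient_mk {σ : Type*} {P : Ideal (MvPolynomial σ ℂ)} {q : σ → ℂ}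
    (hq : q ∈ zeroLocus ℂ P) (r : MvPolynomial σ ℂ) :
    evalQuotient hq (Ideal.Quotient.mk P r) = aeval q r := rfl

/-- Nullstellensatz for quotients of polynomial rings. -/
theorem exists_mem_zeroLocus_of_isMaximal {σ : Type*} [Finite σ] {P : Ideal (MvPolynomial σ ℂ)}
    {N : Ideal (MvPolynomial σ ℂ ⧸ P)} (hN : N.IsMaximal) :
    ∃ q, ∃ hq : q ∈ zeroLocus ℂ P, ∀ a, a ∈ N ↔ evalQuotient hq a = 0 := by
  have hM : (N.comap (Ideal.Quotient.mk P)).IsMaximal :=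
    Ideal.comap_isMaximal_of_surjective _ Ideal.Quotient.mk_surjective
  obtain ⟨q, hq⟩ := eq_vanishingIdeal_singleton_of_isMaximal ℂ hM
  have key (r : MvPolynomial σ ℂ) : Ideal.Quotient.mk P r ∈ N ↔ aeval q r = 0 := by
    rw [← Ideal.mem_comap, hq, mem_vanishingIdeal_singleton_iff]
  refine ⟨q, fun r hr => (key r).1 ?_, fun a => ?_⟩
  · rw [Ideal.Quotient.eq_zero_iff_mem.2 hr]
    exact N.zero_mem
  · obtain ⟨r, rfl⟩ := Ideal.Quotient.mk_surjective a
    exact key r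

theorem exists_eval_ne_zero_of_mem_nhds {s : ℕ} {b : MvPolynomial (Fin s) ℂ} (hb : b ≠ 0)
    {y : Fin s → ℂ} {U : Set (Fin s → ℂ)} (hU : U ∈ nhds y) : ∃ y' ∈ U, eval y' b ≠ 0 := by
  obtain ⟨ε, hε, hU⟩ := Metric.mem_nhds_iff.1 hU
  by_contra! h
  refine hb (funext_set (fun i => Metric.ball (y i) ε) (fun i => ?_) fun x hx => ?_)
  · exact infinite_of_mem_nhds (y i) (Metric.ball_mem_nhds _ hε)
  · rw [h x (hU _), map_zero]
    rw [ball_pi _ hε]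
    exact hx

/-- A monic complex polynomial with a small constant coefficient has a small root. -/
theorem exists_root_norm_lt {Q : Polynomial ℂ} (hQ : Q.Monic) {ε : ℝ} (hε : 0 < ε)
    (h : ‖Q.coeff 0‖ < ε ^ Q.natDegree) : ∃ r, Q.IsRoot r ∧ ‖r‖ < ε := by
  by_contra! hr
  have hs := IsAlgClosed.splits Q
  have key (S : Multiset ℂ) (hS : ∀ r ∈ S, ε ≤ ‖r‖) : ε ^ Multiset.card S ≤ ‖S.prod‖ := by
    induction S using Multiset.induction_on with
    | empty => simp
    | cons a S ih =>
      rw [Multiset.card_cons, Multiset.prod_cons, norm_mul, pow_succ']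
      exact mul_le_mul (hS a (by simp)) (ih fun r hr => hS r (by simp [hr])) (by positivity)
        (norm_nonneg _)
  have := key Q.roots fun r h => hr r (Polynomial.isRoot_of_mem_roots h)
  rw [← hs.natDegree_eq_card_roots] at this
  rw [hs.coeff_zero_eq_prod_roots_of_monic hQ, norm_mul, norm_pow, norm_neg, norm_one, one_pow,
    one_mul] at h
  exact absurd h (not_lt.2 this)

/-- The roots of a monic polynomial whose coefficients depend polynomially on `y` stay bounded
while `y` stays in a bounded set. -/
theorem exists_root_bound {s : ℕ} {m : Polynomial (MvPolynomial (Fin s) ℂ)} (hm : m.Monic)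
    (y : Fin s → ℂ) : ∃ C : ℝ, ∀ y' ∈ Metric.closedBall y 1, ∀ r,
      (m.map (eval y')).IsRoot r → ‖r‖ ≤ C := by
  have hc (j : ℕ) : ∃ C : NNReal, ∀ y' ∈ Metric.closedBall y 1, ‖eval y' (m.coeff j)‖₊ ≤ C := by
    obtain ⟨C, hC⟩ := (isCompact_closedBall y 1).exists_bound_of_continuousOn
      (MvPolynomial.continuous_eval (m.coeff j)).continuousOn
    exact ⟨C.toNNReal, fun y' hy' => NNReal.le_toNNReal_of_coe_le (hC y' hy')⟩
  choose C hC using hc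
  refine ⟨(Finset.range m.natDegree).sup C + 1, fun y' hy' r hr => ?_⟩
  have hm' := hm.map (eval y')
  have h := (hr.norm_lt_cauchyBound hm'.ne_zero).le
  refine (NNReal.coe_le_coe.2 (h.trans ?_ : ‖r‖₊ ≤ (Finset.range m.natDegree).sup C + 1)).trans
    (by simp)
  rw [Polynomial.cauchyBound, hm'.leadingCoeff, nnnorm_one, div_one, hm.natDegree_map]
  gcongr with j hj
  rw [Polynomial.coeff_map]
  exact hC j y' hy'

/-- Over an integrally closed domain `B`, every root of a specialisation of the minimal
polynomial of `a` is the value of `a` at a maximal ideal over the specialisation. -/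
theorem exists_isMaximal_of_isRoot_minpoly {B A : Type*} [CommRing B] [IsDomain B]
    [IsIntegrallyClosed B] [CommRing A] [IsDomain A] [Algebra B A] [Module.IsTorsionFree B A]
    [Algebra.IsIntegral B A] (φ : B →+* ℂ) (hφ : Function.Surjective φ) (a : A) {b : B}
    (h : ((minpoly B a).map φ).IsRoot (φ b)) :
    ∃ N : Ideal A, N.IsMaximal ∧ (∀ b, algebraMap B A b ∈ N ↔ φ b = 0) ∧
      a - algebraMap B A b ∈ N := by
  -- `A` is integral over the image of `B[T]`, which is `B[T] / (minpoly B a)` as `B` is integrally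
  -- closed, so the maximal ideal `(ker φ, T - b)` lies under one of `A`
  let Φ : Polynomial B →+* A := (Polynomial.aeval a : Polynomial B →ₐ[B] A).toRingHom
  let ψ : Polynomial B →+* ℂ := Polynomial.eval₂RingHom φ (φ b)
  have hC (b : B) : Φ (Polynomial.C b) = algebraMap B A b := Polynomial.aeval_C _ _
  have hψC (b : B) : ψ (Polynomial.C b) = φ b := Polynomial.eval₂_C _ _
  have hψ : Function.Surjective ψ := fun z => by
    obtain ⟨b, rfl⟩ := hφ z
    exact ⟨Polynomial.C b, hψC b⟩
  have hΦ : Φ.IsIntegral := by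
    have h : (algebraMap B A).IsIntegral := Algebra.IsIntegral.isIntegral
    rw [show algebraMap B A = Φ.comp Polynomial.C from RingHom.ext fun b => (hC b).symm] at h
    exact h.tower_top _ _
  let := Φ.toAlgebra
  have : Algebra.IsIntegral (Polynomial B) A := ⟨hΦ⟩
  have := RingHom.ker_isMaximal_of_surjective ψ hψ
  obtain ⟨N, hN, hcomap⟩ := Ideal.exists_ideal_over_maximal_of_isIntegral (S := A)
    (RingHom.ker ψ) (fun p hp => by
      obtain ⟨q, rfl⟩ := minpoly.isIntegrallyClosed_dvd (Algebra.IsIntegral.isIntegral a)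
        (show Polynomial.aeval a p = 0 from hp)
      rw [RingHom.mem_ker, map_mul]
      have : ψ (minpoly B a) = 0 := by
        rw [Polynomial.IsRoot, Polynomial.eval_map] at h
        exact h
      rw [this, zero_mul])
  have key (p : Polynomial B) : Φ p ∈ N ↔ ψ p = 0 := by
    rw [← RingHom.mem_ker, ← hcomap]; rfl
  refine ⟨N, hN, fun b => by rw [← hC, key, hψC], ?_⟩
  have := (key (Polynomial.X - Polynomial.C b)).2 (by
    rw [map_sub, hψC, sub_eq_zero]
    exact Polynomial.eval₂_X _ _)
  rw [map_sub, hC] at this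
  rwa [show Φ Polynomial.X = a from Polynomial.aeval_X a] at this

/-- A polynomial that vanishes at a given point and at no point of a given finite set. -/
theorem exists_separating_polynomial {σ : Type*} (p : σ → ℂ) {F : Set (σ → ℂ)} (hF : F.Finite)
    (hp : p ∉ F) : ∃ g : MvPolynomial σ ℂ, aeval p g = 0 ∧ ∀ q ∈ F, aeval q g ≠ 0 := by
  obtain ⟨h, h₁, h₂⟩ : ∃ h : MvPolynomial σ ℂ, aeval p h ≠ 0 ∧ ∀ q ∈ F, aeval q h = 0 := by
    induction F, hF using Set.Finite.induction_on with
    | empty => exact ⟨1, by simp, by simp⟩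
    | @insert a F _ _ ih =>
      obtain ⟨h, h₁, h₂⟩ := ih fun h => hp (Set.mem_insert_of_mem _ h)
      obtain ⟨i, hi⟩ := Function.ne_iff.1 fun h : p = a => hp (h ▸ Set.mem_insert _ _)
      refine ⟨h * (X i - C (a i)), ?_, ?_⟩
      · rw [map_mul, map_sub, aeval_X, aeval_C]
        exact mul_ne_zero h₁ (sub_ne_zero.2 hi)
      · rintro q (rfl | hq)
        · simp
        · rw [map_mul, h₂ q hq, zero_mul]
  refine ⟨h - C (aeval p h), by simp, fun q hq => ?_⟩
  rw [map_sub, h₂ q hq, aeval_C, zero_sub]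
  exact neg_ne_zero.2 h₁

/-- A nonempty Zariski open subset of an irreducible complex variety is dense in it for the
usual topology. -/
theorem exists_mem_zeroLocus_aeval_ne_zero {σ : Type*} [Finite σ] {P : Ideal (MvPolynomial σ ℂ)}
    [hP : P.IsPrime] {f : MvPolynomial σ ℂ} (hf : f ∉ P) {p : σ → ℂ} (hp : p ∈ zeroLocus ℂ P)
    {U : Set (σ → ℂ)} (hU : U ∈ nhds p) : ∃ q ∈ zeroLocus ℂ P, q ∈ U ∧ aeval q f ≠ 0 := by
  cases nonempty_fintype σ
  let A := MvPolynomial σ ℂ ⧸ P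
  obtain ⟨s, g, hg, hgi⟩ := exists_integral_inj_algHom_of_fg ℂ A
  let B := MvPolynomial (Fin s) ℂ
  let : Algebra B A := g.toRingHom.toAlgebra
  have halg (b : B) : algebraMap B A b = g b := rfl
  have : Algebra.IsIntegral B A := ⟨hgi⟩
  let : Module B A := Algebra.toModule
  have : FaithfulSMul B A := (faithfulSMul_iff_algebraMap_injective B A).2 hg
  have : Module.IsTorsionFree B A := inferInstance
  -- the projection of the variety to affine space, in coordinates
  choose G hG using fun i : Fin s => Ideal.Quotient.mk_surjective (g (X i))
  let π : (σ → ℂ) → Fin s → ℂ := fun q i => aeval q (G i)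
  have hcont (r : MvPolynomial σ ℂ) : Continuous fun q : σ → ℂ => aeval q r := by
    exact MvPolynomial.continuous_eval r
  have hπ : Continuous π := continuous_pi fun i => hcont (G i)
  have hev {q : σ → ℂ} (hq : q ∈ zeroLocus ℂ P) (b : B) :
      evalQuotient hq (algebraMap B A b) = eval (π q) b := by
    have : (evalQuotient hq).comp g = aeval (π q) := by
      ext i
      simp only [AlgHom.comp_apply, ← hG, evalQuotient_mk, aeval_X, π]
    rw [halg, ← AlgHom.comp_apply, this]
    rfl
  have hroot {q : σ → ℂ} (hq : q ∈ zeroLocus ℂ P) (a : A) :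
      ((minpoly B a).map (eval (π q))).IsRoot (evalQuotient hq a) := by
    have h : ((evalQuotient hq).toRingHom.comp (algebraMap B A)) = eval (π q) :=
      RingHom.ext (hev hq)
    have h0 := congrArg (evalQuotient hq) (minpoly.aeval B a)
    rw [map_zero, Polynomial.aeval_def] at h0
    rw [Polynomial.IsRoot, Polynomial.eval_map, ← h]
    rw [← h0]
    exact (Polynomial.hom_eval₂ _ _ (evalQuotient hq).toRingHom _).symm
  have hmonic (a : A) : (minpoly B a).Monic := minpoly.monic (Algebra.IsIntegral.isIntegral a)
  -- points over a neighbourhood of `π p` outside a given neighbourhood of `p`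
  obtain ⟨V, hVU, hVo, hpV⟩ := mem_nhds_iff.1 hU
  let T : Set (σ → ℂ) := zeroLocus ℂ P ∩ (Vᶜ ∩ π ⁻¹' Metric.closedBall (π p) 1)
  have hTclosed : IsClosed T := by
    refine IsClosed.inter ?_ (hVo.isClosed_compl.inter (Metric.isClosed_closedBall.preimage hπ))
    have : zeroLocus ℂ P = ⋂ r ∈ P, {q : σ → ℂ | aeval q r = 0} := by
      ext q; simp
    rw [this]
    exact isClosed_biInter fun r _ => isClosed_eq (hcont r) continuous_const
  have hT : IsCompact T := by
    choose C hC using fun i : σ =>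
      exists_root_bound (hmonic (Ideal.Quotient.mk P (X i))) (π p)
    refine (isCompact_univ_pi fun i => isCompact_closedBall (0 : ℂ) (C i)).of_isClosed_subset
      hTclosed fun q hq i _ => ?_
    have := hC i (π q) hq.2.2 _ (hroot hq.1 (Ideal.Quotient.mk P (X i)))
    rw [evalQuotient_mk, aeval_X] at this
    simpa using this
  have hF : (T ∩ {q | π q = π p}).Finite := by
    refine (Set.Finite.pi' fun i : σ => Polynomial.finite_setOfPred_isRoot
      ((hmonic (Ideal.Quotient.mk P (X i))).map (eval (π p))).ne_zero).subset fun q hq i => ?_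
    have := hroot hq.1.1 (Ideal.Quotient.mk P (X i))
    rwa [evalQuotient_mk, aeval_X, show π q = π p from hq.2] at this
  obtain ⟨h, hph, hFh⟩ := exists_separating_polynomial p hF fun h => h.1.2.1 hpV
  obtain ⟨δ, hδ, hTδ⟩ := hT.exists_forall_le' (a := (0 : ℝ))
    (f := fun q => ‖π q - π p‖ + ‖aeval q h‖)
    ((((hπ.sub continuous_const).norm).add (hcont h).norm).continuousOn) (fun q hq => by
      by_cases hqp : π q = π p
      · have := norm_pos_iff.2 (hFh q ⟨hq, hqp⟩)
        positivity
      · have := norm_pos_iff.2 (sub_ne_zero.2 hqp)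
        positivity)
  -- a point near `π p` over which `f` does not vanish and `h` takes a small value
  let a : A := Ideal.Quotient.mk P h
  let m := minpoly B a
  obtain ⟨b, hb, hfb⟩ := (Algebra.IsIntegral.isIntegral (R := B)
    (Ideal.Quotient.mk P f : A)).isAlgebraic.exists_nonzero_dvd
    (mem_nonZeroDivisors_of_ne_zero (mt Ideal.Quotient.eq_zero_iff_mem.1 hf))
  have hm0 : eval (π p) (m.coeff 0) = 0 := by
    have := hroot hp a
    rw [evalQuotient_mk, hph, Polynomial.IsRoot, ← Polynomial.coeff_zero_eq_eval_zero,
      Polynomial.coeff_map] at this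
    exact this
  have hnear : {y | ‖eval y (m.coeff 0)‖ < (δ / 2) ^ m.natDegree} ∈ nhds (π p) := by
    refine (isOpen_lt (MvPolynomial.continuous_eval _).norm continuous_const).mem_nhds ?_
    simp only [Set.mem_ofPred_eq, hm0, norm_zero]
    positivity
  obtain ⟨y, ⟨hy₁, hy₂⟩, hyb⟩ := exists_eval_ne_zero_of_mem_nhds hb
    (Filter.inter_mem hnear (Metric.ball_mem_nhds (π p) (lt_min one_pos (half_pos hδ))))
  obtain ⟨r, hr, hrδ⟩ := exists_root_norm_lt ((hmonic a).map (eval y)) (half_pos hδ) (by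
    rw [Polynomial.coeff_map, (hmonic a).natDegree_map]
    exact hy₁)
  obtain ⟨N, hN, hN₁, hN₂⟩ := exists_isMaximal_of_isRoot_minpoly (B := B) (A := A) (eval y)
    (fun z => ⟨C z, eval_C z⟩) a (b := C r) (by rwa [eval_C])
  obtain ⟨q, hq, hqN⟩ := exists_mem_zeroLocus_of_isMaximal hN
  have hπq : π q = y := by
    funext i
    have := (hN₁ (X i - C (y i))).2 (by rw [map_sub, eval_X, eval_C, sub_self])
    rw [hqN, hev] at this
    simpa [sub_eq_zero] using this
  have hqh : aeval q h = r := by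
    rw [hqN, map_sub, hev, evalQuotient_mk, eval_C, sub_eq_zero] at hN₂
    exact hN₂
  refine ⟨q, hq, ?_, fun hqf => ?_⟩
  · by_contra hqU
    have hlt : ‖y - π p‖ < min 1 (δ / 2) := by simpa [dist_eq_norm] using hy₂
    have := hTδ q ⟨hq, fun h => hqU (hVU h), by
      rw [Set.mem_preimage, hπq, Metric.mem_closedBall, dist_eq_norm]
      exact (hlt.trans_le (min_le_left _ _)).le⟩
    rw [hπq, hqh] at this
    have := hlt.trans_le (min_le_right _ _)
    linarith
  · obtain ⟨c, hc⟩ := hfb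
    refine hyb ?_
    rw [← hπq, ← hev hq, hc, map_mul, evalQuotient_mk, hqf, zero_mul]

end Density

/-! ### Chevalley's theorem and Zariski open subsets -/

section Chevalley

open MvPolynomial

/-- Membership in a constructible set is constant on a nonempty open part of the closure of any
point of a prime spectrum. -/
theorem exists_notMem_of_isConstructible {R : Type*} [CommRing R] {C : Set (PrimeSpectrum R)}
    (hC : Topology.IsConstructible C) (P : PrimeSpectrum R) : ∃ h, h ∉ P.asIdeal ∧
      ((∀ Q : PrimeSpectrum R, P ≤ Q → h ∉ Q.asIdeal → Q ∈ C) ∨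
        ∀ Q : PrimeSpectrum R, P ≤ Q → h ∉ Q.asIdeal → Q ∉ C) := by
  have one_notMem : (1 : R) ∉ P.asIdeal := fun h => P.2.ne_top (P.asIdeal.eq_top_iff_one.2 h)
  induction hC using Topology.IsConstructible.empty_union_induction with
  | open_retrocompact U hU _ =>
    by_cases hP : P ∈ U
    · obtain ⟨_, ⟨h, rfl⟩, hPh, hhU⟩ :=
        PrimeSpectrum.isTopologicalBasis_basic_opens.exists_subset_of_mem_open hP hU
      exact ⟨h, hPh, .inl fun Q _ hQ => hhU hQ⟩
    · refine ⟨1, one_notMem, .inr fun Q hPQ _ hQ => hP ?_⟩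
      exact ((PrimeSpectrum.le_iff_specializes P Q).1 hPQ).mem_open hU hQ
  | union s _ t _ ihs iht =>
    obtain ⟨h, hP, hs⟩ := ihs
    obtain ⟨k, kP, ht⟩ := iht
    refine ⟨h * k, fun hk => (P.2.mem_or_mem hk).elim hP kP, ?_⟩
    have left {Q : PrimeSpectrum R} (H : h * k ∉ Q.asIdeal) : h ∉ Q.asIdeal :=
      fun H' => H (Ideal.mul_mem_right _ _ H')
    have right {Q : PrimeSpectrum R} (H : h * k ∉ Q.asIdeal) : k ∉ Q.asIdeal :=
      fun H' => H (Ideal.mul_mem_left _ _ H')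
    rcases hs with hs | hs
    · exact .inl fun Q hPQ hQ => .inl (hs Q hPQ (left hQ))
    rcases ht with ht | ht
    · exact .inl fun Q hPQ hQ => .inr (ht Q hPQ (right hQ))
    · exact .inr fun Q hPQ hQ => not_or.2 ⟨hs Q hPQ (left hQ), ht Q hPQ (right hQ)⟩
  | compl s _ ih =>
    obtain ⟨h, hP, hs⟩ := ih
    exact ⟨h, hP, hs.symm.imp (fun H Q hPQ hQ => H Q hPQ hQ)
      fun H Q hPQ hQ hQs => hQs (H Q hPQ hQ)⟩

/-- The projection to `ℂ^σ` of an algebraic set in `ℂ^(σ ⊕ τ)` contains, or is disjoint from, a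
nonempty Zariski open subset of any given irreducible variety. -/
theorem exists_notMem_forall_mem_projection {σ τ : Type*} [Finite σ] [Finite τ]
    (J : Ideal (MvPolynomial (σ ⊕ τ) ℂ)) (P : Ideal (MvPolynomial σ ℂ)) [hP : P.IsPrime] :
    ∃ h ∉ P,
      (∀ x ∈ zeroLocus ℂ P, aeval x h ≠ 0 → ∃ y : τ → ℂ, Sum.elim x y ∈ zeroLocus ℂ J) ∨
      ∀ x ∈ zeroLocus ℂ P, aeval x h ≠ 0 → ¬∃ y : τ → ℂ, Sum.elim x y ∈ zeroLocus ℂ J := by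
  let i : MvPolynomial σ ℂ →ₐ[ℂ] MvPolynomial (σ ⊕ τ) ℂ ⧸ J :=
    (Ideal.Quotient.mkₐ ℂ J).comp (rename Sum.inl)
  have hi : i.toRingHom.FinitePresentation := by
    refine RingHom.FinitePresentation.of_finiteType.1 ?_
    refine RingHom.FiniteType.of_comp_finiteType (f := algebraMap ℂ (MvPolynomial σ ℂ)) ?_
    rw [show i.toRingHom.comp (algebraMap ℂ (MvPolynomial σ ℂ)) = algebraMap ℂ _ from
      i.comp_algebraMap, RingHom.finiteType_algebraMap]
    infer_instance
  have hev {w : σ ⊕ τ → ℂ} (hw : w ∈ zeroLocus ℂ J) (r : MvPolynomial σ ℂ) :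
      evalQuotient hw (i r) = aeval (fun s => w (.inl s)) r := by
    change aeval w (rename Sum.inl r) = _
    rw [aeval_rename]
    rfl
  -- the points of the projection are the closed points of the image of the spectrum
  have hpt (x : σ → ℂ) : (∃ y : τ → ℂ, Sum.elim x y ∈ zeroLocus ℂ J) ↔
      pointToPoint x ∈ Set.range (PrimeSpectrum.comap i.toRingHom) := by
    constructor
    · rintro ⟨y, hy⟩
      refine ⟨⟨RingHom.ker (evalQuotient hy), RingHom.ker_isPrime _⟩, PrimeSpectrum.ext ?_⟩
      ext r
      refine Iff.trans ?_ (mem_vanishingIdeal_singleton_iff x r).symm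
      change evalQuotient hy (i r) = 0 ↔ _
      rw [hev]
      rfl
    · rintro ⟨Q, hQ⟩
      obtain ⟨N, hN, hQN⟩ := Q.asIdeal.exists_le_maximal Q.2.ne_top
      obtain ⟨w, hw, hwN⟩ := exists_mem_zeroLocus_of_isMaximal hN
      refine ⟨fun t => w (.inr t), ?_⟩
      convert hw
      ext (s | t)
      · have hs : X s - C (x s) ∈ (pointToPoint x : PrimeSpectrum (MvPolynomial σ ℂ)).asIdeal :=
          (mem_vanishingIdeal_singleton_iff x _).2 (by simp)
        rw [← hQ] at hs
        have := (hwN _).1 (hQN hs)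
        change evalQuotient hw (i _) = 0 at this
        rw [hev, map_sub, aeval_X, aeval_C, sub_eq_zero] at this
        exact this.symm
      · rfl
  obtain ⟨h, hhP, hh⟩ := exists_notMem_of_isConstructible
    (PrimeSpectrum.isConstructible_range_comap hi) ⟨P, hP⟩
  have hle {x : σ → ℂ} (hx : x ∈ zeroLocus ℂ P) :
      (⟨P, hP⟩ : PrimeSpectrum (MvPolynomial σ ℂ)) ≤ pointToPoint x :=
    fun r hr => (mem_vanishingIdeal_singleton_iff x r).2 (hx r hr)
  have hne {x : σ → ℂ} (hx : aeval x h ≠ 0) : h ∉ (pointToPoint x).asIdeal :=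
    fun H => hx ((mem_vanishingIdeal_singleton_iff x h).1 H)
  refine ⟨h, hhP, hh.imp (fun H x hx hxh => ?_) fun H x hx hxh => ?_⟩
  · exact (hpt x).2 (H _ (hle hx) (hne hxh))
  · exact (hpt x).not.2 (H _ (hle hx) (hne hxh))

/-- If `P` is a minimal prime over the ideal of `S`, the points of `S` on the variety of `P` are
Zariski dense in it. -/
theorem exists_mem_aeval_ne_zero_of_mem_minimalPrimes {σ : Type*} [Finite σ] {S : Set (σ → ℂ)}
    {P : Ideal (MvPolynomial σ ℂ)} (hP : P ∈ (vanishingIdeal ℂ S).minimalPrimes)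
    {h : MvPolynomial σ ℂ} (hh : h ∉ P) : ∃ z ∈ S, z ∈ zeroLocus ℂ P ∧ aeval z h ≠ 0 := by
  have hPp : P.IsPrime := hP.1.1
  -- a product `E` of elements outside `P`, one from each of the other minimal primes; a point of
  -- `S` where `E` does not vanish lies on no component other than that of `P`
  let M := (vanishingIdeal ℂ S).minimalPrimes \ {P}
  have hM : M.Finite :=
    (Ideal.finite_minimalPrimes_of_isNoetherianRing _ (vanishingIdeal ℂ S)).sdiff
  have hex (Q : Ideal (MvPolynomial σ ℂ)) : ∃ e, e ∉ P ∧ (Q ∈ M → e ∈ Q) := by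
    by_cases hQ : Q ∈ M
    · obtain ⟨e, heQ, heP⟩ := SetLike.not_le_iff_exists.1 fun hle : Q ≤ P =>
        hQ.2 (le_antisymm hle (hP.2 hQ.1.1 hle))
      exact ⟨e, heP, fun _ => heQ⟩
    · exact ⟨1, fun h => hPp.ne_top (P.eq_top_iff_one.2 h), fun h => absurd h hQ⟩
  choose e heP heM using hex
  let E := ∏ Q ∈ hM.toFinset, e Q
  have hE : E ∉ P := fun hE => by
    obtain ⟨Q, -, hQ⟩ := (hPp.prod_mem_iff).1 hE
    exact heP Q hQ
  have hEh : E * h ∉ vanishingIdeal ℂ S := fun H =>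
    (hPp.mem_or_mem (hP.1.2 H)).elim hE hh
  rw [mem_vanishingIdeal_iff] at hEh
  push Not at hEh
  obtain ⟨z, hz, hzE⟩ := hEh
  rw [map_mul] at hzE
  refine ⟨z, hz, ?_, right_ne_zero_of_mul hzE⟩
  obtain ⟨Q, hQ, hQz⟩ := Ideal.exists_minimalPrimes_le
    (vanishingIdeal_anti_mono (k := ℂ) (Set.singleton_subset_iff.2 hz))
  by_cases hQP : Q = P
  · subst hQP
    exact fun r hr => (mem_vanishingIdeal_singleton_iff z r).1 (hQz hr)
  · refine absurd ?_ (left_ne_zero_of_mul hzE)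
    have : E ∈ Q := Ideal.prod_mem Q (hM.mem_toFinset.2 ⟨hQ, hQP⟩) (heM Q ⟨hQ, hQP⟩)
    exact (mem_vanishingIdeal_singleton_iff z E).1 (hQz this)

/-- In an algebraic set `L`, a subset that is the projection of an algebraic set and is open for
the usual topology is Zariski open. -/
theorem isZariskiOpenIn_of_forall_mem_nhds {σ τ : Type*} [Finite σ] [Finite τ]
    {L O : Set (σ → ℂ)} {I : Ideal (MvPolynomial σ ℂ)} (hL : L = zeroLocus ℂ I) (hOL : O ⊆ L)
    {J : Ideal (MvPolynomial (σ ⊕ τ) ℂ)}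
    (hO : ∀ x, x ∈ O ↔ ∃ y : τ → ℂ, Sum.elim x y ∈ zeroLocus ℂ J)
    (hopen : ∀ x ∈ O, ∃ U ∈ nhds x, L ∩ U ⊆ O) : IsZariskiOpenIn L O := by
  refine ⟨vanishingIdeal ℂ (L \ O), Set.Subset.antisymm (fun x hx => ⟨hOL hx, fun hxI => ?_⟩)
    fun x hx => by_contra fun hxO => hx.2 (zeroLocus_vanishingIdeal_le _ ⟨hx.1, hxO⟩)⟩
  obtain ⟨P, hP, hPx⟩ := Ideal.exists_minimalPrimes_le (J := vanishingIdeal ℂ {x})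
    (I := vanishingIdeal ℂ (L \ O))
    fun r hr => (mem_vanishingIdeal_singleton_iff x r).2 (hxI r hr)
  have hPp : P.IsPrime := hP.1.1
  have hxP : x ∈ zeroLocus ℂ P := fun r hr => (mem_vanishingIdeal_singleton_iff x r).1 (hPx hr)
  have hPL : zeroLocus ℂ P ⊆ L := by
    rw [hL]
    refine zeroLocus_anti_mono (le_trans ?_ hP.1.2)
    refine (le_vanishingIdeal_zeroLocus (K := ℂ) I).trans (vanishingIdeal_anti_mono ?_)
    rw [← hL]
    exact Set.sdiff_subset
  obtain ⟨h, hhP, hh | hh⟩ := exists_notMem_forall_mem_projection J P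
  · obtain ⟨z, hz, hzP, hzh⟩ := exists_mem_aeval_ne_zero_of_mem_minimalPrimes hP hhP
    exact hz.2 ((hO z).2 (hh z hzP hzh))
  · obtain ⟨U, hU, hLU⟩ := hopen x hx
    obtain ⟨q, hqP, hqU, hqh⟩ := exists_mem_zeroLocus_aeval_ne_zero hhP hxP hU
    exact hh q hqP hqh ((hO q).1 (hLU ⟨hPL hqP, hqU⟩))

end Chevalley

/-! ### Lie algebra laws, their isomorphisms and rigidity -/

section Algebraic

open MvPolynomial

variable {σ : Type*}

/-- The function `f` on `ℂ^σ` is polynomial. -/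
def IsPolynomialFun (f : (σ → ℂ) → ℂ) : Prop :=
  ∃ p : MvPolynomial σ ℂ, ∀ x, aeval x p = f x

namespace IsPolynomialFun

theorem var (i : σ) : IsPolynomialFun fun x : σ → ℂ => x i :=
  ⟨X i, fun x => aeval_X x i⟩

theorem const (z : ℂ) : IsPolynomialFun fun _ : σ → ℂ => z :=
  ⟨C z, fun x => aeval_C x z⟩

theorem add {f g : (σ → ℂ) → ℂ} (hf : IsPolynomialFun f) (hg : IsPolynomialFun g) :
    IsPolynomialFun fun x => f x + g x := by
  obtain ⟨p, hp⟩ := hf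
  obtain ⟨q, hq⟩ := hg
  exact ⟨p + q, fun x => by rw [map_add, hp, hq]⟩

theorem mul {f g : (σ → ℂ) → ℂ} (hf : IsPolynomialFun f) (hg : IsPolynomialFun g) :
    IsPolynomialFun fun x => f x * g x := by
  obtain ⟨p, hp⟩ := hf
  obtain ⟨q, hq⟩ := hg
  exact ⟨p * q, fun x => by rw [map_mul, hp, hq]⟩

theorem neg {f : (σ → ℂ) → ℂ} (hf : IsPolynomialFun f) : IsPolynomialFun fun x => -f x := by
  obtain ⟨p, hp⟩ := hf
  exact ⟨-p, fun x => by rw [map_neg, hp]⟩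

theorem sum {ι : Type*} (s : Finset ι) {f : ι → (σ → ℂ) → ℂ} (hf : ∀ i, IsPolynomialFun (f i)) :
    IsPolynomialFun fun x => ∑ i ∈ s, f i x := by
  choose p hp using hf
  exact ⟨∑ i ∈ s, p i, fun x => by simp only [map_sum, hp]⟩

end IsPolynomialFun

/-- The points with property `P` form an algebraic subset of `ℂ^σ`. -/
def IsAlgebraicSet (P : (σ → ℂ) → Prop) : Prop :=
  ∃ J : Ideal (MvPolynomial σ ℂ), ∀ x, x ∈ zeroLocus ℂ J ↔ P x

namespace IsAlgebraicSet

theorem eq {f g : (σ → ℂ) → ℂ} (hf : IsPolynomialFun f) (hg : IsPolynomialFun g) :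
    IsAlgebraicSet fun x => f x = g x := by
  obtain ⟨p, hp⟩ := hf
  obtain ⟨q, hq⟩ := hg
  refine ⟨Ideal.span {p - q}, fun x => ?_⟩
  simp only [zeroLocus_span, Set.mem_singleton_iff, forall_eq, Set.mem_ofPred_eq, map_sub,
    sub_eq_zero, hp, hq]

theorem all {ι : Type*} {P : ι → (σ → ℂ) → Prop} (h : ∀ i, IsAlgebraicSet (P i)) :
    IsAlgebraicSet fun x => ∀ i, P i x := by
  choose J hJ using h
  have key (x : σ → ℂ) (I : Ideal (MvPolynomial σ ℂ)) :
      x ∈ zeroLocus ℂ I ↔ I ≤ vanishingIdeal ℂ {x} :=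
    forall₂_congr fun r _ => (mem_vanishingIdeal_singleton_iff x r).symm
  exact ⟨⨆ i, J i, fun x => by simp only [key, iSup_le_iff, ← hJ]⟩

theorem and {P Q : (σ → ℂ) → Prop} (hP : IsAlgebraicSet P) (hQ : IsAlgebraicSet Q) :
    IsAlgebraicSet fun x => P x ∧ Q x := by
  have := all (P := fun b : Bool => if b then P else Q) (by simp [hP, hQ])
  simpa only [Bool.forall_bool, and_comm, if_true, Bool.false_eq_true, if_false] using this

end IsAlgebraicSet

end Algebraic

section Laws

variable {n : ℕ} {F : Type*} [Field F]

/-- The bracket as a bilinear map. -/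
def bracketBilin (c : Idx n → F) : (Fin n → F) →ₗ[F] (Fin n → F) →ₗ[F] (Fin n → F) :=
  LinearMap.mk₂ F (bracket c)
    (fun X X' Y => funext fun k => by
      simp only [bracket, Pi.add_apply, add_mul, Finset.sum_add_distrib])
    (fun z X Y => funext fun k => by
      simp only [bracket, Pi.smul_apply, smul_eq_mul, Finset.mul_sum, mul_assoc])
    (fun X Y Y' => funext fun k => by
      simp only [bracket, Pi.add_apply, add_mul, mul_add, Finset.sum_add_distrib])
    (fun z X Y => funext fun k => by
      simp only [bracket, Pi.smul_apply, smul_eq_mul, Finset.mul_sum, mul_assoc, mul_left_comm])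

/-- The structure constants of a bilinear map. -/
def structureConstants (B : (Fin n → F) →ₗ[F] (Fin n → F) →ₗ[F] (Fin n → F)) : Idx n → F :=
  fun a => B (Pi.single a.1 1) (Pi.single a.2.1 1) a.2.2

theorem bracket_structureConstants
    (B : (Fin n → F) →ₗ[F] (Fin n → F) →ₗ[F] (Fin n → F)) (X Y : Fin n → F) :
    bracket (structureConstants B) X Y = B X Y := by
  conv_rhs => rw [pi_eq_sum_univ' X, pi_eq_sum_univ' Y]
  funext k
  simp only [bracket, structureConstants, map_sum, map_smul, LinearMap.sum_apply,
    LinearMap.smul_apply, Finset.sum_apply, Pi.smul_apply, smul_eq_mul, mul_assoc, Finset.mul_sum,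
    mul_left_comm (Y _)]
  exact Finset.sum_comm

theorem structureConstants_bracketBilin (c : Idx n → F) :
    structureConstants (bracketBilin c) = c := by
  funext ⟨i, j, k⟩
  simp only [structureConstants, bracketBilin, LinearMap.mk₂_apply, bracket, Pi.single_apply,
    ite_mul, mul_ite, one_mul, zero_mul, mul_zero, mul_one, Finset.sum_ite_eq', Finset.mem_univ,
    if_true]

theorem bracket_injective : Function.Injective (bracket : (Idx n → F) → _) := fun c c' h => by
  rw [← structureConstants_bracketBilin c, ← structureConstants_bracketBilin c']
  funext a
  exact congrFun (congrFun (congrFun h _) _) _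

/-- The law `f(μ(f⁻¹ X, f⁻¹ Y))`, in structure constants. -/
def pushLaw (f : (Fin n → F) ≃ₗ[F] (Fin n → F)) (c : Idx n → F) : Idx n → F :=
  structureConstants (((bracketBilin c).compl₁₂ f.symm.toLinearMap f.symm.toLinearMap).compr₂
    f.toLinearMap)

theorem bracket_pushLaw (f : (Fin n → F) ≃ₗ[F] (Fin n → F)) (c : Idx n → F) (X Y : Fin n → F) :
    bracket (pushLaw f c) X Y = f (bracket c (f.symm X) (f.symm Y)) := by
  rw [pushLaw, bracket_structureConstants]
  rfl

theorem IsLieLaw.pushLaw {c : Idx n → F} (hc : IsLieLaw c)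
    (f : (Fin n → F) ≃ₗ[F] (Fin n → F)) : IsLieLaw (pushLaw f c) := by
  refine ⟨fun X Y => ?_, fun X Y Z => ?_⟩
  · rw [bracket_pushLaw, bracket_pushLaw, hc.1, map_neg]
  · simp only [bracket_pushLaw, LinearEquiv.symm_apply_apply, ← map_add, hc.2, map_zero]

theorem continuous_pushLaw (f : (Fin n → ℂ) ≃ₗ[ℂ] (Fin n → ℂ)) : Continuous (pushLaw f) := by
  refine continuous_pi fun a => (continuous_apply a.2.2).comp
    (f.toLinearMap.continuous_of_finiteDimensional.comp ?_)
  change Continuous fun c => bracket c (f.symm (Pi.single a.1 1)) (f.symm (Pi.single a.2.1 1))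
  unfold bracket
  fun_prop

theorem IsLieLaw.of_isIsomorphicLaw {c c' : Idx n → F} (hc : IsLieLaw c)
    (h : IsIsomorphicLaw c' c) : IsLieLaw c' := by
  obtain ⟨f, hf⟩ := h
  rw [bracket_injective (funext₂ fun X Y => (hf X Y).trans (bracket_pushLaw f.symm c X Y).symm)]
  exact hc.pushLaw f.symm

/-- Multiplication of a vector by a matrix, the matrix being a function on pairs of indices. -/
def matVec (M : Fin n × Fin n → F) (X : Fin n → F) : Fin n → F :=
  fun i => ∑ j, M (i, j) * X j

/-- The matrix on the left summand is invertible, with inverse the matrix on the right summand,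
and is an isomorphism of the law `c'` onto the law `c`. -/
def IsIsomorphismPair (c' c : Idx n → F) (y : (Fin n × Fin n) ⊕ (Fin n × Fin n) → F) : Prop :=
  (∀ X : Fin n → F, matVec (fun a => y (.inr a)) (matVec (fun a => y (.inl a)) X) = X) ∧
    (∀ X : Fin n → F, matVec (fun a => y (.inl a)) (matVec (fun a => y (.inr a)) X) = X) ∧
      ∀ X Y : Fin n → F, matVec (fun a => y (.inl a)) (bracket c' X Y) =
        bracket c (matVec (fun a => y (.inl a)) X) (matVec (fun a => y (.inl a)) Y)

theorem isIsomorphicLaw_iff {c' c : Idx n → F} :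
    IsIsomorphicLaw c' c ↔ ∃ y, IsIsomorphismPair c' c y := by
  have hmat (f : (Fin n → F) →ₗ[F] (Fin n → F)) (X : Fin n → F) :
      matVec (fun a => LinearMap.toMatrix' f a.1 a.2) X = f X :=
    LinearMap.toMatrix'_mulVec f X
  constructor
  · rintro ⟨f, hf⟩
    refine ⟨Sum.elim (fun a => LinearMap.toMatrix' f.toLinearMap a.1 a.2)
      (fun a => LinearMap.toMatrix' f.symm.toLinearMap a.1 a.2), ?_, ?_, ?_⟩ <;>
    simp only [Sum.elim_inl, Sum.elim_inr, hmat, LinearEquiv.coe_coe,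
      LinearEquiv.symm_apply_apply, LinearEquiv.apply_symm_apply, implies_true, hf]
  · rintro ⟨y, h₁, h₂, h₃⟩
    let M (e : Fin n × Fin n → F) : (Fin n → F) →ₗ[F] (Fin n → F) :=
      Matrix.mulVecLin (Matrix.of fun i j => e (i, j))
    refine ⟨LinearEquiv.ofLinearMap (M fun a => y (.inl a)) (M fun a => y (.inr a))
      (LinearMap.ext h₂) (LinearMap.ext h₁), fun X Y => ?_⟩
    rw [LinearEquiv.eq_symm_apply]
    exact h₃ X Y

end Laws

section AlgebraicLaws

variable {n : ℕ} {σ : Type*}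

theorem IsPolynomialFun.bracket {c : Idx n → (σ → ℂ) → ℂ} {X Y : Fin n → (σ → ℂ) → ℂ}
    (hc : ∀ a, IsPolynomialFun (c a)) (hX : ∀ i, IsPolynomialFun (X i))
    (hY : ∀ i, IsPolynomialFun (Y i)) (k : Fin n) :
    IsPolynomialFun fun x => bracket (fun a => c a x) (fun i => X i x) (fun i => Y i x) k :=
  .sum _ fun i => .sum _ fun j => ((hX i).mul (hY j)).mul (hc _)

theorem IsPolynomialFun.matVec {M : Fin n × Fin n → (σ → ℂ) → ℂ} {X : Fin n → (σ → ℂ) → ℂ}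
    (hM : ∀ a, IsPolynomialFun (M a)) (hX : ∀ i, IsPolynomialFun (X i)) (i : Fin n) :
    IsPolynomialFun fun x => matVec (fun a => M a x) (fun i => X i x) i :=
  .sum _ fun j => (hM _).mul (hX j)

/-- The Lie algebra laws form an algebraic set. -/
theorem isAlgebraicSet_isLieLaw : IsAlgebraicSet fun c : Idx n → ℂ => IsLieLaw c := by
  have hb {X Y : Fin n → (Idx n → ℂ) → ℂ} (hX : ∀ i, IsPolynomialFun (X i))
      (hY : ∀ i, IsPolynomialFun (Y i)) :=
    IsPolynomialFun.bracket (fun a => .var a) hX hY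
  have hc (X : Fin n → ℂ) (i : Fin n) : IsPolynomialFun fun _ : Idx n → ℂ => X i := .const _
  simp only [IsLieLaw, funext_iff, Pi.neg_apply, Pi.add_apply, Pi.zero_apply]
  refine .and (.all fun X => .all fun Y => .all fun k => .eq (hb (hc X) (hc Y) k)
    (hb (hc Y) (hc X) k).neg)
    (.all fun X => .all fun Y => .all fun Z => .all fun k => .eq ?_ (.const 0))
  exact ((hb (hc X) (hb (hc Y) (hc Z)) k).add (hb (hc Y) (hb (hc Z) (hc X)) k)).add
    (hb (hc Z) (hb (hc X) (hc Y)) k)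

/-- The laws isomorphic to `c`, together with an isomorphism and its inverse, form an algebraic
set. -/
theorem isAlgebraicSet_isIsomorphismPair (c : Idx n → ℂ) :
    IsAlgebraicSet fun w : Idx n ⊕ ((Fin n × Fin n) ⊕ (Fin n × Fin n)) → ℂ =>
      IsIsomorphismPair (fun a => w (.inl a)) c fun b => w (.inr b) := by
  simp only [IsIsomorphismPair, funext_iff]
  let V := Idx n ⊕ ((Fin n × Fin n) ⊕ (Fin n × Fin n)) → ℂ
  have hM {X : Fin n → V → ℂ} (hX : ∀ i, IsPolynomialFun (X i)) (i : Fin n) :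
      IsPolynomialFun fun w : V =>
        matVec (fun a => w (.inr (.inl a))) (fun j => X j w) i :=
    IsPolynomialFun.matVec (M := fun a w => w (.inr (.inl a))) (fun a => .var _) hX i
  have hN {X : Fin n → V → ℂ} (hX : ∀ i, IsPolynomialFun (X i)) (i : Fin n) :
      IsPolynomialFun fun w : V =>
        matVec (fun a => w (.inr (.inr a))) (fun j => X j w) i :=
    IsPolynomialFun.matVec (M := fun a w => w (.inr (.inr a))) (fun a => .var _) hX i
  have hX (X : Fin n → ℂ) (i : Fin n) : IsPolynomialFun fun _ : V => X i := .const _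
  refine .and (.all fun X => .all fun i => .eq (hN (hM (hX X)) i) (.const (X i)))
    (.and (.all fun X => .all fun i => .eq (hM (hN (hX X)) i) (.const (X i)))
      (.all fun X => .all fun Y => .all fun i => .eq (hM (fun j => ?_) i) ?_))
  · exact IsPolynomialFun.bracket (c := fun a w => w (.inl a)) (fun a => .var _) (hX X) (hX Y) j
  · exact IsPolynomialFun.bracket (c := fun a _ => c a) (fun a => .const _) (hM (hX X))
      (hM (hX Y)) i

/-- A complex Lie algebra is rigid if and only if all laws sufficiently close to its law, in the
usual topology, are isomorphic to it. -/
theorem isRigid_iff {μ : Idx n → ℂ} (hμ : IsLieLaw μ) :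
    IsRigid μ ↔ ∃ ε : ℝ, 0 < ε ∧ ∀ c : Idx n → ℂ, IsLieLaw c → (∀ a, ‖c a - μ a‖ < ε) →
      IsIsomorphicLaw c μ := by
  have hnear (c : Idx n → ℂ) {ε : ℝ} (hε : 0 < ε) :
      c ∈ Metric.ball μ ε ↔ ∀ a, ‖c a - μ a‖ < ε := by
    rw [Metric.mem_ball, dist_pi_lt_iff hε]
    simp only [dist_eq_norm]
  constructor
  · rintro ⟨I, hI⟩
    have hclosed : IsClosed (MvPolynomial.zeroLocus ℂ I : Set (Idx n → ℂ)) := by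
      have : MvPolynomial.zeroLocus ℂ I =
          ⋂ r ∈ I, {x : Idx n → ℂ | MvPolynomial.eval x r = 0} := by
        ext x; simp
      rw [this]
      exact isClosed_biInter fun r _ => isClosed_eq (MvPolynomial.continuous_eval r)
        continuous_const
    have hμO : μ ∈ orbit μ := ⟨LinearEquiv.refl ℂ _, fun X Y => rfl⟩
    rw [hI] at hμO
    obtain ⟨ε, hε, hεI⟩ := Metric.isOpen_iff.1 hclosed.isOpen_compl μ hμO.2
    refine ⟨ε, hε, fun c hc hcμ => ?_⟩
    change c ∈ orbit μ
    rw [hI]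
    exact ⟨hc, hεI ((hnear c hε).2 hcμ)⟩
  · rintro ⟨ε, hε, hεμ⟩
    obtain ⟨I, hI⟩ := isAlgebraicSet_isLieLaw (n := n)
    obtain ⟨J, hJ⟩ := isAlgebraicSet_isIsomorphismPair μ
    refine isZariskiOpenIn_of_forall_mem_nhds (I := I) (J := J)
      (Set.ext fun c => (hI c).symm) (fun c hc => hμ.of_isIsomorphicLaw hc) (fun c => ?_) ?_
    · refine isIsomorphicLaw_iff.trans (exists_congr fun y => ?_)
      exact (hJ (Sum.elim c y)).symm
    -- homogeneity of the orbit: a neighbourhood of `μ` is moved to one of `c`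
    · rintro c ⟨f, hf⟩
      have hcμ : pushLaw f c = μ := bracket_injective (funext₂ fun X Y => by
        rw [bracket_pushLaw, hf]; simp only [LinearEquiv.apply_symm_apply])
      refine ⟨pushLaw f ⁻¹' Metric.ball μ ε, (continuous_pushLaw f).continuousAt.preimage_mem_nhds
        (hcμ ▸ Metric.ball_mem_nhds _ hε), fun d hd => ?_⟩
      obtain ⟨g, hg⟩ := hεμ _ (hd.1.pushLaw f) ((hnear _ hε).1 hd.2)
      refine ⟨f.trans g, fun X Y => ?_⟩
      have := hg (f X) (f Y)
      rw [bracket_pushLaw, f.symm_apply_apply, f.symm_apply_apply, ← f.eq_symm_apply] at this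
      exact this

end AlgebraicLaws

/-! ### Perturbations of Lie algebra laws -/

section Nonstandard

variable {K : Type*} [Field K] [fullLang.Structure K] {σ : Type*}

namespace IsRobinsonExtension

variable {n : ℕ}

theorem sameTerm_bracket (hK : IsRobinsonExtension K) {c : Idx n → (σ → ℂ) → ℂ}
    {c' : Idx n → (σ → K) → K} (hc : ∀ a, SameTerm (c a) (c' a)) {X Y : Fin n → (σ → ℂ) → ℂ}
    {X' Y' : Fin n → (σ → K) → K} (hX : ∀ i, SameTerm (X i) (X' i))
    (hY : ∀ i, SameTerm (Y i) (Y' i)) (k : Fin n) :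
    SameTerm (fun v => bracket (fun a => c a v) (fun i => X i v) (fun i => Y i v) k)
      (fun v => bracket (fun a => c' a v) (fun i => X' i v) (fun i => Y' i v) k) :=
  hK.sameTerm_sum _ fun i => hK.sameTerm_sum _ fun j =>
    hK.sameTerm_mul (hK.sameTerm_mul (hX i) (hY j)) (hc _)

theorem sameTerm_matVec (hK : IsRobinsonExtension K) {M : Fin n × Fin n → (σ → ℂ) → ℂ}
    {M' : Fin n × Fin n → (σ → K) → K} (hM : ∀ a, SameTerm (M a) (M' a))
    {X : Fin n → (σ → ℂ) → ℂ} {X' : Fin n → (σ → K) → K} (hX : ∀ i, SameTerm (X i) (X' i))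
    (i : Fin n) :
    SameTerm (fun v => matVec (fun a => M a v) (fun i => X i v) i)
      (fun v => matVec (fun a => M' a v) (fun i => X' i v) i) :=
  hK.sameTerm_sum _ fun _ => hK.sameTerm_mul (hM _) (hX _)

theorem sameFormula_isLieLaw (hK : IsRobinsonExtension K) {c : Idx n → (σ → ℂ) → ℂ}
    {c' : Idx n → (σ → K) → K} (hc : ∀ a, SameTerm (c a) (c' a)) :
    SameFormula (fun v => IsLieLaw fun a => c a v) (fun v => IsLieLaw fun a => c' a v) := by
  simp only [IsLieLaw, funext_iff, Pi.neg_apply, Pi.add_apply, Pi.zero_apply]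
  refine .and (.all <| .all <| .finiteAll fun k => ?_)
    (.all <| .all <| .all <| .finiteAll fun k => ?_)
  · have hc₂ (a : Idx n) :=
      ((hc a).relabel (Sum.inl (β := Fin n))).relabel (Sum.inl (β := Fin n))
    have hX (i : Fin n) := SameTerm.var (K := K) (Sum.inl (Sum.inr i) : (σ ⊕ Fin n) ⊕ Fin n)
    have hY (i : Fin n) := SameTerm.var (K := K) (Sum.inr i : (σ ⊕ Fin n) ⊕ Fin n)
    exact .eq (hK.sameTerm_bracket hc₂ hX hY k)
      (hK.sameTerm_neg (hK.sameTerm_bracket hc₂ hY hX k))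
  · have hc₃ (a : Idx n) := (((hc a).relabel (Sum.inl (β := Fin n))).relabel
      (Sum.inl (β := Fin n))).relabel (Sum.inl (β := Fin n))
    have hX (i : Fin n) := SameTerm.var (K := K)
      (Sum.inl (Sum.inl (Sum.inr i)) : ((σ ⊕ Fin n) ⊕ Fin n) ⊕ Fin n)
    have hY (i : Fin n) := SameTerm.var (K := K)
      (Sum.inl (Sum.inr i) : ((σ ⊕ Fin n) ⊕ Fin n) ⊕ Fin n)
    have hZ (i : Fin n) := SameTerm.var (K := K)
      (Sum.inr i : ((σ ⊕ Fin n) ⊕ Fin n) ⊕ Fin n)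
    exact .eq (hK.sameTerm_add (hK.sameTerm_add
      (hK.sameTerm_bracket hc₃ hX (hK.sameTerm_bracket hc₃ hY hZ) k)
      (hK.sameTerm_bracket hc₃ hY (hK.sameTerm_bracket hc₃ hZ hX) k))
      (hK.sameTerm_bracket hc₃ hZ (hK.sameTerm_bracket hc₃ hX hY) k)) hK.sameTerm_zero

theorem sameFormula_isIsomorphismPair (hK : IsRobinsonExtension K)
    {c d : Idx n → (σ → ℂ) → ℂ} {c' d' : Idx n → (σ → K) → K}
    {y : (Fin n × Fin n) ⊕ (Fin n × Fin n) → (σ → ℂ) → ℂ}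
    {y' : (Fin n × Fin n) ⊕ (Fin n × Fin n) → (σ → K) → K}
    (hc : ∀ a, SameTerm (c a) (c' a)) (hd : ∀ a, SameTerm (d a) (d' a))
    (hy : ∀ a, SameTerm (y a) (y' a)) :
    SameFormula
      (fun v => IsIsomorphismPair (fun a => c a v) (fun a => d a v) fun b => y b v)
      (fun v => IsIsomorphismPair (fun a => c' a v) (fun a => d' a v) fun b => y' b v) := by
  simp only [IsIsomorphismPair, funext_iff]
  have hX (i : Fin n) := SameTerm.var (K := K) (Sum.inr i : σ ⊕ Fin n)
  have hM (a : Fin n × Fin n) := (hy (.inl a)).relabel (Sum.inl (β := Fin n))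
  have hN (a : Fin n × Fin n) := (hy (.inr a)).relabel (Sum.inl (β := Fin n))
  refine .and (.all <| .finiteAll fun i =>
      .eq (hK.sameTerm_matVec hN (hK.sameTerm_matVec hM hX) i) (hX i))
    (.and (.all <| .finiteAll fun i =>
      .eq (hK.sameTerm_matVec hM (hK.sameTerm_matVec hN hX) i) (hX i))
    (.all <| .all <| .finiteAll fun i => ?_))
  have hc₂ (a : Idx n) := ((hc a).relabel (Sum.inl (β := Fin n))).relabel (Sum.inl (β := Fin n))
  have hd₂ (a : Idx n) := ((hd a).relabel (Sum.inl (β := Fin n))).relabel (Sum.inl (β := Fin n))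
  have hM₂ (a : Fin n × Fin n) := (hM a).relabel (Sum.inl (β := Fin n))
  have hX₂ (i : Fin n) := (hX i).relabel (Sum.inl (β := Fin n))
  have hY (i : Fin n) := SameTerm.var (K := K) (Sum.inr i : (σ ⊕ Fin n) ⊕ Fin n)
  exact .eq (hK.sameTerm_matVec hM₂ (hK.sameTerm_bracket hc₂ hX₂ hY) i)
    (hK.sameTerm_bracket hd₂ (hK.sameTerm_matVec hM₂ hX₂) (hK.sameTerm_matVec hM₂ hY) i)

theorem sameFormula_isIsomorphicLaw (hK : IsRobinsonExtension K)
    {c d : Idx n → (σ → ℂ) → ℂ} {c' d' : Idx n → (σ → K) → K}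
    (hc : ∀ a, SameTerm (c a) (c' a)) (hd : ∀ a, SameTerm (d a) (d' a)) :
    SameFormula (fun v => IsIsomorphicLaw (fun a => c a v) fun a => d a v)
      (fun v => IsIsomorphicLaw (fun a => c' a v) fun a => d' a v) := by
  simp only [isIsomorphicLaw_iff]
  exact .ex (hK.sameFormula_isIsomorphismPair (fun a => (hc a).relabel _)
    (fun a => (hd a).relabel _) fun b => SameTerm.var _)

/-- The transfer principle for universally quantified statements. -/
theorem forall_of_sameFormula (hK : IsRobinsonExtension K) [Finite σ] {P : (σ → ℂ) → Prop}
    {Q : (σ → K) → Prop} (h : SameFormula P Q) (hP : ∀ v, P v) (v : σ → K) : Q v := by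
  have h' : SameFormula (σ := Empty) (K := K) (fun _ => ∀ v, P v) (fun _ => ∀ v, Q v) := by
    obtain ⟨φ, h₁, h₂⟩ := h
    exact .all (P := fun _ x => P x) (Q := fun _ x => Q x)
      ⟨φ.relabel Sum.inr, fun w => by
        rw [FirstOrder.Language.Formula.realize_relabel, h₁]; rfl, fun w => by
        rw [FirstOrder.Language.Formula.realize_relabel, h₂]; rfl⟩
  exact (h'.transfer hK.transfer Empty.elim).1 hP v

theorem isLimited_of_isInfinitesimal_sub_std (hK : IsRobinsonExtension K) {x : K} {z : ℂ}
    (h : IsInfinitesimal (x - std K z)) : IsLimited x := by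
  refine ⟨‖z‖ + 1, hK.forall_of_sameFormula (σ := Unit) (.imp
    (.rel₁ {v | ‖v 0‖ < 1} (hK.sameTerm_sub (.var ()) (.const z)))
    (.rel₁ {v | ‖v 0‖ ≤ ‖z‖ + 1} (.var ()))) (fun v hv => ?_) (fun _ => x) (h 1 one_pos)⟩
  change ‖v () - z‖ < 1 at hv
  change ‖v ()‖ ≤ ‖z‖ + 1
  have := norm_le_norm_add_norm_sub' (v ()) z
  linarith

theorem isInfinitesimal_of_norm_lt (hK : IsRobinsonExtension K) {x e : K}
    (he : IsInfinitesimal e) (h : ![x, e] ∈ starSet (K := K) {v : Fin 2 → ℂ | ‖v 0‖ < ‖v 1‖}) :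
    IsInfinitesimal x := by
  intro r hr
  refine hK.forall_of_sameFormula (σ := Fin 2) (.imp (.rel₂ {v | ‖v 0‖ < ‖v 1‖} (.var 0) (.var 1))
    (.imp (.rel₁ {v | ‖v 0‖ < r} (.var 1)) (.rel₁ {v | ‖v 0‖ < r} (.var 0))))
    (fun v h₁ h₂ => ?_) ![x, e] h (he r hr)
  change ‖v 0‖ < ‖v 1‖ at h₁
  change ‖v 1‖ < r at h₂
  exact h₁.trans h₂

/-- Every limited element is infinitely close to a standard one: its standard part. -/
theorem exists_isInfinitesimal_sub_std (hK : IsRobinsonExtension K) {x : K} (hx : IsLimited x) :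
    ∃ z, IsInfinitesimal (x - std K z) := by
  obtain ⟨R, hR⟩ := hx
  by_contra! h
  simp only [IsInfinitesimal] at h
  push Not at h
  choose r hr hxr using h
  -- finitely many of the discs around standard points that omit `x` cover the disc of radius `R`
  obtain ⟨t, -, ht⟩ := (isCompact_closedBall (0 : ℂ) R).elim_nhds_subcover
    (fun z => Metric.ball z (r z)) fun z _ => Metric.ball_mem_nhds z (hr z)
  obtain ⟨z, hz⟩ := hK.forall_of_sameFormula (σ := Unit) (.imp (.rel₁ {v | ‖v 0‖ ≤ R} (.var ()))
    (.finiteEx fun z : t => .rel₁ {v | ‖v 0‖ < r z} (hK.sameTerm_sub (.var ()) (.const z))))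
    (fun v hv => by
      obtain ⟨z, hzt, hz⟩ := Set.mem_iUnion₂.1 (ht (show v () ∈ _ from mem_closedBall_zero_iff.2 hv))
      exact ⟨⟨z, hzt⟩, mem_ball_iff_norm.1 hz⟩) (fun _ => x) hR
  exact hxr z hz

theorem exists_isInfinitesimal_ne_zero (hK : IsRobinsonExtension K) :
    ∃ e : K, e ≠ 0 ∧ IsInfinitesimal e := by
  obtain ⟨x, hx⟩ := hK.exists_nonstandard
  by_cases hl : IsLimited x
  · obtain ⟨z, hz⟩ := hK.exists_isInfinitesimal_sub_std hl
    exact ⟨x - std K z, sub_ne_zero.2 (hx z), hz⟩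
  -- the inverse of an infinitely large element is infinitesimal
  · have hx0 : x ≠ 0 := fun h => hx 0 (h.trans hK.std_zero.symm)
    refine ⟨x⁻¹, inv_ne_zero hx0, fun r hr => ?_⟩
    refine hK.forall_of_sameFormula (σ := Fin 2) (.imp
      (.eq (hK.sameTerm_mul (.var 0) (.var 1)) (.const 1))
      (.imp (.not (.rel₁ {v | ‖v 0‖ ≤ r⁻¹} (.var 0))) (.rel₁ {v | ‖v 0‖ < r} (.var 1))))
      (fun v h₁ h₂ => ?_) ![x, x⁻¹] ?_ fun h => hl ⟨r⁻¹, h⟩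
    · change ¬‖v 0‖ ≤ r⁻¹ at h₂
      change ‖v 1‖ < r
      rw [eq_inv_of_mul_eq_one_right h₁, norm_inv]
      exact inv_lt_of_inv_lt₀ hr (not_le.1 h₂)
    · rw [hK.std_one]
      exact mul_inv_cancel₀ hx0

end IsRobinsonExtension

/-- The laws sufficiently close to `μ` are isomorphic to `μ` if and only if the perturbations of
`μ` are. -/
theorem exists_forall_isIsomorphicLaw_iff (hK : IsRobinsonExtension K) {n : ℕ} (μ : Idx n → ℂ) :
    (∃ ε : ℝ, 0 < ε ∧ ∀ c : Idx n → ℂ, IsLieLaw c → (∀ a, ‖c a - μ a‖ < ε) →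
      IsIsomorphicLaw c μ) ↔
    ∀ μ' : Idx n → K, IsPerturbation μ' μ → IsIsomorphicLaw μ' (extendLaw K μ) := by
  constructor
  · rintro ⟨ε, hε, h⟩ μ' ⟨hμ', -, hμ'μ⟩
    exact hK.forall_of_sameFormula (σ := Idx n) (.imp (hK.sameFormula_isLieLaw fun a => .var a)
      (.imp (.finiteAll fun a => .rel₁ {v | ‖v 0‖ < ε}
        (hK.sameTerm_sub (.var a) (.const (μ a))))
        (hK.sameFormula_isIsomorphicLaw (fun a => .var a) fun a => .const (μ a))))
      (fun c => h c) μ' hμ' fun a => hμ'μ a ε hε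
  · intro h
    by_contra! hno
    obtain ⟨e, he0, he⟩ := hK.exists_isInfinitesimal_ne_zero
    -- at an infinitesimal scale the extension has a law close to `μ` and not isomorphic to it
    obtain ⟨μ', hμ', hnear, hiso⟩ := hK.forall_of_sameFormula (σ := Unit)
      (.imp (.not (.eq (.var ()) hK.sameTerm_zero)) (.ex (τ := Idx n)
        (P := fun v c => IsLieLaw c ∧ (∀ a, ![c a - μ a, v ()] ∈ {v | ‖v 0‖ < ‖v 1‖}) ∧
          ¬IsIsomorphicLaw c μ)
        (Q := fun v c => IsLieLaw c ∧
          (∀ a, ![c a - std K (μ a), v ()] ∈ starSet {v : Fin 2 → ℂ | ‖v 0‖ < ‖v 1‖}) ∧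
          ¬IsIsomorphicLaw c (extendLaw K μ))
        (.and (hK.sameFormula_isLieLaw fun a => .var _)
          (.and (.finiteAll fun a => .rel₂ _
            (hK.sameTerm_sub (.var _) (.const (μ a))) (.var _))
          (.not (hK.sameFormula_isIsomorphicLaw (fun a => .var _) fun a => .const (μ a)))))))
      (fun v hv => hno ‖v ()‖ (norm_pos_iff.2 hv)) (fun _ => e) he0
    have hinf (a : Idx n) := hK.isInfinitesimal_of_norm_lt he (hnear a)
    exact hiso (h μ' ⟨hμ', fun a => hK.isLimited_of_isInfinitesimal_sub_std (hinf a), hinf⟩)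

end Nonstandard

end LieRigidity

theorem mainTheorem12 {K : Type*} [Field K] [LieRigidity.fullLang.Structure K]
    (hK : LieRigidity.IsRobinsonExtension K)
    (n : ℕ) (μ : LieRigidity.Idx n → ℂ) (hμ : LieRigidity.IsLieLaw μ) :
    LieRigidity.IsRigid μ ↔
      ∀ μ' : LieRigidity.Idx n → K, LieRigidity.IsPerturbation μ' μ →
        LieRigidity.IsIsomorphicLaw μ' (LieRigidity.extendLaw K μ) :=
  (LieRigidity.isRigid_iff hμ).trans (LieRigidity.exists_forall_isIsomorphicLaw_iff hK μ)
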